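/- Let $K$ be a commutative ring. A $K$-algebra $A$ is called left strongly Noetherian if $A$ is left Noetherian and $C\otimes_K A$ is left Noetherian for every commutative Noetherian $K$-algebra $C$. Let $R$ be a left strongly Noetherian $K$-algebra. Let $n\ge 2$ and $0\le r\le n$, let $q=(q_{ij})\in M_n(R)$ be a matrix with $q_{ii}=1=q_{ij}q_{ji}$ for all $1\le i,j\le n$, and let $\sigma_1,\dots,\sigma_n$ be ring automorphisms of $R$. Let $$Q=Q^{r,n}_{q,\sigma}=R_{q,\sigma}[x_1^{\pm1},\dots,x_r^{\pm1},x_{r+1},\dots,x_n]$$ be a ring of skew quantum polynomials over $R$ that is a $K$-algebra extending the $K$-algebra structure of $R$. That is, $Q$ is a $K$-algebra containing $R$ as a $K$-subalgebra, with elements $x_1,\dots,x_n\in Q$ such that: 1. $x_1,\dots,x_r$ are invertible in $Q$; 2. $Q$ is a free left $R$-module with basis the monomials $x_1^{\alpha_1}\cdots x_n^{\alpha_n}$, where $\alpha_i\in\mathbb Z$ for $1\le i\le r$ and $\alpha_i\in\mathbb N=\{0,1,2,\dots\}$ for $r+1\le i\le n$; 3. $x_jx_i=q_{ij}x_ix_j$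 and $x_ia=\sigma_i(a)x_i$ for all $a\in R$ and $1\le i,j\le n$. Then the $K$-algebra $Q$ is left strongly Noetherian. -/

import Mathlib

open scoped TensorProduct

universe w u v t

/-- A `K`-algebra `A` is left strongly Noetherian if it is left Noetherian and `C ⊗[K] A` is left
Noetherian for every commutative Noetherian `K`-algebra `C`. (In Mathlib `IsNoetherianRing` means
left Noetherian. The universe `w` of the test algebras `C` is a free parameter.) -/
def IsLeftStronglyNoetherian (K : Type u) (A : Type v) [CommRing K] [Ring A]
    [Algebra K A] : Prop :=
  IsNoetherianRing A ∧
    ∀ (C : Type w) [CommRing C] [Algebra K C], IsNoetherianRing C → IsNoetherianRing (C ⊗[K] A)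

namespace SkewQuantum

/-- Integer powers of an element `a` of a ring: `a ^ m` for `m ≥ 0` and `(a⁻¹) ^ (-m)` for `m < 0`.
Negative powers are used only for units, where `Ring.inverse a` is the two-sided inverse. -/
noncomputable def intPow {Q : Type*} [Ring Q] (a : Q) : ℤ → Q
  | Int.ofNat k => a ^ k
  | Int.negSucc k => Ring.inverse a ^ (k + 1)

/-- The exponents `α = (α₁, …, αₙ)` with `αᵢ ∈ ℤ` for the first `r` indices and `αᵢ ∈ ℕ` for the
others (indices are counted from `0` in `Fin n`). -/
def exponents (r n : ℕ) : Set (Fin n → ℤ) :=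
  {α | ∀ i : Fin n, r ≤ (i : ℕ) → 0 ≤ α i}

/-- The ordered monomial `x₁ ^ α₁ * x₂ ^ α₂ * ⋯ * xₙ ^ αₙ`. -/
noncomputable def monomial {Q : Type*} [Ring Q] {n : ℕ} (x : Fin n → Q) (α : Fin n → ℤ) : Q :=
  (List.ofFn fun i => intPow (x i) (α i)).prod

/-- `IsSkewQuantumPolynomialRing r q σ ι x`: the ring `Q`, containing `R` through `ι` and with
distinguished elements `x₁, …, xₙ`, is the ring of skew quantum polynomials
`R_{q,σ}[x₁^{±1}, …, x_r^{±1}, x_{r+1}, …, xₙ]`. -/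
structure IsSkewQuantumPolynomialRing {R Q : Type*} [Ring R] [Ring Q] {n : ℕ} (r : ℕ)
    (q : Matrix (Fin n) (Fin n) R) (σ : Fin n → (R ≃+* R)) (ι : R →+* Q) (x : Fin n → Q) :
    Prop where
  /-- `R ⊆ Q`. -/
  injective : Function.Injective ι
  /-- `x₁, …, x_r` have two-sided inverses. -/
  isUnit : ∀ i : Fin n, (i : ℕ) < r → IsUnit (x i)
  /-- The monomials form a basis of `Q` as a left `R`-module: every element of `Q` is a finite left
  `R`-linear combination of them in exactly one way. -/
  basis : Function.Bijective
    (fun c : exponents r n →₀ R => c.sum fun α a => ι a * monomial x (α : Fin n → ℤ))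
  /-- `x_j x_i = q_{ij} x_i x_j`. -/
  mul_comm_var : ∀ i j : Fin n, x j * x i = ι (q i j) * x i * x j
  /-- `x_i a = σ_i(a) x_i` for `a ∈ R`. -/
  mul_coeff : ∀ (i : Fin n) (a : R), x i * ι a = ι (σ i a) * x i

end SkewQuantum

/-! Call `x` normal over a subring when it can be moved past the subring's elements in both
directions, at the cost of changing them. A skew Hilbert basis theorem
(`isNoetherianRing_of_closure_insert`) shows that adjoining one normal element preserves left
Noetherianity. Since the `xᵢ` normalize `R` and commute up to coefficients in `R`, each is normal
over the ring generated by `R` and any of the others, so the theorem iterates. The inverses come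
last: they are a left localization at normal units, and left ideals of the localization are
determined by their contractions.

This argument needs only generators and commutation relations, and both pass to `C ⊗ Q` over the
image of `C ⊗ R`, which is left Noetherian as a quotient of `C ⊗ R`. -/

namespace SkewQuantum

/-! ### Skew Hilbert basis theorem -/

section HilbertBasis

variable {S T : Type*} [Ring S] [Ring T]

/-- The additive subgroup of elements `∑ i < m, x ^ i * f (sᵢ)`. -/
def degreeLT (f : S →+* T) (x : T) (m : ℕ) : AddSubgroup T :=
  AddSubgroup.closure {t | ∃ i < m, ∃ s, x ^ i * f s = t}

variable {f : S →+* T} {x : T}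

theorem pow_mul_mem_degreeLT {i m : ℕ} (h : i < m) (s : S) : x ^ i * f s ∈ degreeLT f x m :=
  AddSubgroup.subset_closure ⟨i, h, s, rfl⟩

theorem degreeLT_mono {m m' : ℕ} (h : m ≤ m') : degreeLT f x m ≤ degreeLT f x m' :=
  AddSubgroup.closure_mono fun _ ⟨i, hi, s, hs⟩ => ⟨i, hi.trans_le h, s, hs⟩

theorem degreeLT_zero : degreeLT f x 0 = ⊥ := by
  simp [degreeLT]

theorem mul_pow_comm_of_right (hr : ∀ s, ∃ s', f s * x = x * f s') (i : ℕ) (s : S) :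
    ∃ s', f s * x ^ i = x ^ i * f s' := by
  induction i with
  | zero => exact ⟨s, by simp⟩
  | succ i ih =>
    obtain ⟨s', h⟩ := ih
    obtain ⟨s'', h'⟩ := hr s'
    exact ⟨s'', by rw [pow_succ, ← mul_assoc, h, mul_assoc, h', ← mul_assoc]⟩

theorem pow_mul_comm_of_left (hl : ∀ s, ∃ s', x * f s = f s' * x) (i : ℕ) (s : S) :
    ∃ s', x ^ i * f s = f s' * x ^ i := by
  induction i with
  | zero => exact ⟨s, by simp⟩
  | succ i ih =>
    obtain ⟨s', h⟩ := ih
    obtain ⟨s'', h'⟩ := hl s'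
    exact ⟨s'', by rw [pow_succ', mul_assoc, h, ← mul_assoc, h', mul_assoc]⟩

theorem coeff_mul_mem_degreeLT (hr : ∀ s, ∃ s', f s * x = x * f s') {m : ℕ} {t : T}
    (ht : t ∈ degreeLT f x m) (s : S) : f s * t ∈ degreeLT f x m := by
  induction ht using AddSubgroup.closure_induction with
  | mem t ht =>
    obtain ⟨i, hi, a, rfl⟩ := ht
    obtain ⟨s', h⟩ := mul_pow_comm_of_right hr i s
    rw [← mul_assoc, h, mul_assoc, ← map_mul]
    exact pow_mul_mem_degreeLT hi _
  | zero => simp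
  | add a b _ _ ha hb => rw [mul_add]; exact add_mem ha hb
  | neg a _ ha => rw [mul_neg]; exact neg_mem ha

theorem var_mul_mem_degreeLT {m : ℕ} {t : T} (ht : t ∈ degreeLT f x m) :
    x * t ∈ degreeLT f x (m + 1) := by
  induction ht using AddSubgroup.closure_induction with
  | mem t ht =>
    obtain ⟨i, hi, a, rfl⟩ := ht
    rw [← mul_assoc, ← pow_succ']
    exact pow_mul_mem_degreeLT (by omega) _
  | zero => simp
  | add a b _ _ ha hb => rw [mul_add]; exact add_mem ha hb
  | neg a _ ha => rw [mul_neg]; exact neg_mem ha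

theorem exists_leadingCoeff {m : ℕ} {t : T} (ht : t ∈ degreeLT f x (m + 1)) :
    ∃ a, t - x ^ m * f a ∈ degreeLT f x m := by
  induction ht using AddSubgroup.closure_induction with
  | mem t ht =>
    obtain ⟨i, hi, a, rfl⟩ := ht
    rcases Nat.lt_succ_iff_lt_or_eq.mp hi with hi | rfl
    · exact ⟨0, by simpa using pow_mul_mem_degreeLT hi a⟩
    · exact ⟨a, by simp⟩
  | zero => exact ⟨0, by simp⟩
  | add a b _ _ ha hb =>
    obtain ⟨c, hc⟩ := ha
    obtain ⟨d, hd⟩ := hb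
    refine ⟨c + d, ?_⟩
    convert add_mem hc hd using 1
    rw [map_add, mul_add]; abel
  | neg a _ ha =>
    obtain ⟨c, hc⟩ := ha
    refine ⟨-c, ?_⟩
    convert neg_mem hc using 1
    rw [map_neg, mul_neg]; abel

theorem exists_mem_degreeLT (hr : ∀ s, ∃ s', f s * x = x * f s')
    (hgen : Subring.closure (Set.range f ∪ {x}) = ⊤) (t : T) : ∃ m, t ∈ degreeLT f x m := by
  have key : ∀ y ∈ Subring.closure (Set.range f ∪ {x}),
      ∀ t, (∃ m, t ∈ degreeLT f x m) → ∃ m, y * t ∈ degreeLT f x m := by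
    intro y hy
    induction hy using Subring.closure_induction with
    | mem y hy =>
      rintro t ⟨m, ht⟩
      rcases hy with ⟨s, rfl⟩ | rfl
      · exact ⟨m, coeff_mul_mem_degreeLT hr ht s⟩
      · exact ⟨m + 1, var_mul_mem_degreeLT ht⟩
    | zero => exact fun t _ => ⟨0, by simp⟩
    | one => intro t ht; simpa using ht
    | add a b _ _ ha hb =>
      intro t ht
      obtain ⟨m, hm⟩ := ha t ht
      obtain ⟨m', hm'⟩ := hb t ht
      refine ⟨max m m', ?_⟩
      rw [add_mul]
      exact add_mem (degreeLT_mono (le_max_left _ _) hm) (degreeLT_mono (le_max_right _ _) hm')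
    | neg a _ ha =>
      intro t ht
      obtain ⟨m, hm⟩ := ha t ht
      exact ⟨m, by rw [neg_mul]; exact neg_mem hm⟩
    | mul a b _ _ ha hb =>
      intro t ht
      rw [mul_assoc]
      exact ha _ (hb t ht)
  have h1 : (1 : T) ∈ degreeLT f x 1 := by
    simpa using pow_mul_mem_degreeLT (f := f) (x := x) zero_lt_one 1
  simpa using key t (hgen ▸ Subring.mem_top t) 1 ⟨1, h1⟩

/-- The left ideal of the coefficients `a` of `x ^ m` in elements `x ^ m * f a + (lower terms)`
of a left ideal. -/
def leadingCoeffIdeal (hl : ∀ s, ∃ s', x * f s = f s' * x) (hr : ∀ s, ∃ s', f s * x = x * f s')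
    (m : ℕ) (I : Ideal T) : Ideal S where
  carrier := {a | ∃ p ∈ I, p - x ^ m * f a ∈ degreeLT f x m}
  zero_mem' := ⟨0, I.zero_mem, by simp⟩
  add_mem' := by
    rintro a b ⟨p, hp, hpa⟩ ⟨p', hp', hpb⟩
    refine ⟨p + p', I.add_mem hp hp', ?_⟩
    convert add_mem hpa hpb using 1
    rw [map_add, mul_add]; abel
  smul_mem' := by
    rintro s a ⟨p, hp, hpa⟩
    -- Left multiplication by `s'` multiplies the leading coefficient by `s` once it has moved past
    -- `x ^ m`.
    obtain ⟨s', hs⟩ := pow_mul_comm_of_left hl m s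
    refine ⟨f s' * p, I.mul_mem_left _ hp, ?_⟩
    convert coeff_mul_mem_degreeLT hr hpa s' using 1
    rw [smul_eq_mul, map_mul, ← mul_assoc, hs, mul_sub, mul_assoc]

variable (hl : ∀ s, ∃ s', x * f s = f s' * x) (hr : ∀ s, ∃ s', f s * x = x * f s')

/-- Coefficients stand to the right of the powers, so left multiplication by `x` raises the degree
and leaves the leading coefficient unchanged. -/
theorem leadingCoeffIdeal_mono {m m' : ℕ} (h : m ≤ m') {I J : Ideal T} (hIJ : I ≤ J) :
    leadingCoeffIdeal hl hr m I ≤ leadingCoeffIdeal hl hr m' J := by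
  have step : Monotone fun k => leadingCoeffIdeal hl hr k I := by
    refine monotone_nat_of_le_succ fun k => ?_
    rintro a ⟨p, hp, hpa⟩
    refine ⟨x * p, I.mul_mem_left _ hp, ?_⟩
    convert var_mul_mem_degreeLT hpa using 1
    rw [mul_sub, ← mul_assoc, ← pow_succ']
  refine (step h).trans ?_
  rintro a ⟨p, hp, hpa⟩
  exact ⟨p, hIJ hp, hpa⟩

/-- Induction on degree: subtracting an element of `I` with the same leading coefficient lowers the
degree. -/
theorem le_of_leadingCoeffIdeal_le (hgen : Subring.closure (Set.range f ∪ {x}) = ⊤)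
    {I J : Ideal T} (hIJ : I ≤ J)
    (h : ∀ m, leadingCoeffIdeal hl hr m J ≤ leadingCoeffIdeal hl hr m I) : J ≤ I := by
  have key : ∀ m, ∀ p ∈ J, p ∈ degreeLT f x m → p ∈ I := by
    intro m
    induction m with
    | zero =>
      intro p _ hp
      rw [degreeLT_zero, AddSubgroup.mem_bot] at hp
      exact hp ▸ I.zero_mem
    | succ m ih =>
      intro p hpJ hp
      obtain ⟨a, ha⟩ := exists_leadingCoeff hp
      obtain ⟨p', hp', ha'⟩ := h m ⟨p, hpJ, ha⟩
      have := ih (p - p') (J.sub_mem hpJ (hIJ hp')) (by simpa using sub_mem ha ha')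
      simpa using I.add_mem this hp'
  intro p hp
  obtain ⟨m, hm⟩ := exists_mem_degreeLT hr hgen p
  exact key m p hp hm

include hl hr in
/-- Skew Hilbert basis theorem: a ring generated by the image of a left Noetherian ring and one
element normalizing that image is left Noetherian. -/
theorem isNoetherianRing_of_closure_insert [IsNoetherianRing S]
    (hgen : Subring.closure (Set.range f ∪ {x}) = ⊤) : IsNoetherianRing T := by
  rw [isNoetherianRing_iff, ← monotone_stabilizes_iff_noetherian]
  have stab := (monotone_stabilizes_iff_noetherian (R := S) (M := S)).mpr inferInstance
  intro I
  -- The diagonal chain controls all degrees `m ≥ N` at once; the finitely many degrees below `N`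
  -- are stabilized separately by `B`.
  obtain ⟨N, hN⟩ := stab ⟨fun k => leadingCoeffIdeal hl hr k (I k),
    fun a b hab => leadingCoeffIdeal_mono hl hr hab (I.mono hab)⟩
  choose B hB using fun k => stab ⟨fun j => leadingCoeffIdeal hl hr k (I j),
    fun a b hab => leadingCoeffIdeal_mono hl hr le_rfl (I.mono hab)⟩
  replace hN : ∀ k, N ≤ k →
      leadingCoeffIdeal hl hr N (I N) = leadingCoeffIdeal hl hr k (I k) := hN
  replace hB : ∀ m k, B m ≤ k →
      leadingCoeffIdeal hl hr m (I (B m)) = leadingCoeffIdeal hl hr m (I k) := hB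
  set M := max N ((Finset.range N).sup B) with hM
  have hNM : N ≤ M := le_max_left _ _
  refine ⟨M, fun j hj => le_antisymm (I.mono hj) ?_⟩
  refine le_of_leadingCoeffIdeal_le hl hr hgen (I.mono hj) fun m => ?_
  rcases lt_or_ge m N with hm | hm
  · have hBM : B m ≤ M :=
      (Finset.le_sup (f := B) (Finset.mem_range.mpr hm)).trans (le_max_right _ _)
    exact ((hB m M hBM).symm.trans (hB m j (hBM.trans hj))).ge
  · calc leadingCoeffIdeal hl hr m (I j)
        ≤ leadingCoeffIdeal hl hr (max m j) (I (max m j)) :=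
          leadingCoeffIdeal_mono hl hr (le_max_left _ _) (I.mono (le_max_right _ _))
      _ = leadingCoeffIdeal hl hr N (I N) := (hN _ (hm.trans (le_max_left _ _))).symm
      _ ≤ leadingCoeffIdeal hl hr m (I M) := leadingCoeffIdeal_mono hl hr hm (I.mono hNM)

end HilbertBasis

/-! ### Adjoining several normalizing elements -/

section Iteration

variable {T ι : Type*} [Ring T]

theorem exists_mul_eq_mul_of_closure {X : Set T} {y : T}
    (h : ∀ a ∈ X, ∃ b ∈ Subring.closure X, y * a = b * y) :
    ∀ a ∈ Subring.closure X, ∃ b ∈ Subring.closure X, y * a = b * y := by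
  intro a ha
  induction ha using Subring.closure_induction with
  | mem a ha => exact h a ha
  | zero => exact ⟨0, zero_mem _, by simp⟩
  | one => exact ⟨1, one_mem _, by simp⟩
  | add a b _ _ ha hb =>
    obtain ⟨c, hc, hc'⟩ := ha
    obtain ⟨d, hd, hd'⟩ := hb
    exact ⟨c + d, add_mem hc hd, by rw [mul_add, add_mul, hc', hd']⟩
  | neg a _ ha =>
    obtain ⟨c, hc, hc'⟩ := ha
    exact ⟨-c, neg_mem hc, by rw [mul_neg, neg_mul, hc']⟩
  | mul a b _ _ ha hb =>
    obtain ⟨c, hc, hc'⟩ := ha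
    obtain ⟨d, hd, hd'⟩ := hb
    exact ⟨c * d, mul_mem hc hd, by rw [← mul_assoc, hc', mul_assoc, hd', mul_assoc]⟩

theorem exists_mul_eq_mul_of_closure' {X : Set T} {y : T}
    (h : ∀ a ∈ X, ∃ b ∈ Subring.closure X, a * y = y * b) :
    ∀ a ∈ Subring.closure X, ∃ b ∈ Subring.closure X, a * y = y * b := by
  intro a ha
  induction ha using Subring.closure_induction with
  | mem a ha => exact h a ha
  | zero => exact ⟨0, zero_mem _, by simp⟩
  | one => exact ⟨1, one_mem _, by simp⟩
  | add a b _ _ ha hb =>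
    obtain ⟨c, hc, hc'⟩ := ha
    obtain ⟨d, hd, hd'⟩ := hb
    exact ⟨c + d, add_mem hc hd, by rw [mul_add, add_mul, hc', hd']⟩
  | neg a _ ha =>
    obtain ⟨c, hc, hc'⟩ := ha
    exact ⟨-c, neg_mem hc, by rw [mul_neg, neg_mul, hc']⟩
  | mul a b _ _ ha hb =>
    obtain ⟨c, hc, hc'⟩ := ha
    obtain ⟨d, hd, hd'⟩ := hb
    exact ⟨c * d, mul_mem hc hd, by rw [mul_assoc, hd', ← mul_assoc, hc', mul_assoc]⟩

/-- Transfers generation from `T` to the generated subring regarded as a ring in its own right. -/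
theorem closure_preimage_subtype_closure (X : Set T) :
    Subring.closure ((Subring.closure X).subtype ⁻¹' X) = ⊤ := by
  have key : Subring.closure X ≤ (Subring.closure ((Subring.closure X).subtype ⁻¹' X)).map
      (Subring.closure X).subtype :=
    Subring.closure_le.mpr fun a ha =>
      ⟨⟨a, Subring.subset_closure ha⟩, Subring.subset_closure ha, rfl⟩
  rw [eq_top_iff]
  rintro a -
  obtain ⟨b, hb, h⟩ := key a.2
  rwa [← show b = a from Subtype.ext h]

variable {A : Subring T} {x : ι → T}

theorem var_mul_closure (hl : ∀ i, ∀ a ∈ A, ∃ b ∈ A, x i * a = b * x i)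
    (hq : ∀ i j, ∃ b ∈ A, x j * x i = b * x i * x j) (s : Set ι) (i : ι) :
    ∀ a ∈ Subring.closure (A ∪ x '' s), ∃ b ∈ Subring.closure (A ∪ x '' s),
      x i * a = b * x i := by
  have hA : ∀ a ∈ A, a ∈ Subring.closure (A ∪ x '' s) :=
    fun a ha => Subring.subset_closure (Or.inl ha)
  refine exists_mul_eq_mul_of_closure ?_
  rintro a (ha | ⟨j, hj, rfl⟩)
  · obtain ⟨b, hb, h⟩ := hl i a ha
    exact ⟨b, hA b hb, h⟩
  · obtain ⟨b, hb, h⟩ := hq j i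
    exact ⟨b * x j, mul_mem (hA b hb) (Subring.subset_closure (Or.inr ⟨j, hj, rfl⟩)), h⟩

theorem closure_mul_var (hr : ∀ i, ∀ a ∈ A, ∃ b ∈ A, a * x i = x i * b)
    (hq : ∀ i j, ∃ b ∈ A, x j * x i = b * x i * x j) (s : Set ι) (i : ι) :
    ∀ a ∈ Subring.closure (A ∪ x '' s), ∃ b ∈ Subring.closure (A ∪ x '' s),
      a * x i = x i * b := by
  have hA : ∀ a ∈ A, a ∈ Subring.closure (A ∪ x '' s) :=
    fun a ha => Subring.subset_closure (Or.inl ha)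
  refine exists_mul_eq_mul_of_closure' ?_
  rintro a (ha | ⟨j, hj, rfl⟩)
  · obtain ⟨b, hb, h⟩ := hr i a ha
    exact ⟨b, hA b hb, h⟩
  · obtain ⟨b, hb, h⟩ := hq i j
    obtain ⟨c, hc, h'⟩ := hr i b hb
    exact ⟨c * x j, mul_mem (hA c hc) (Subring.subset_closure (Or.inr ⟨j, hj, rfl⟩)),
      by rw [h, h', mul_assoc]⟩

/-- Adjoining to a left Noetherian subring finitely many elements which normalize it and commute
with each other up to its elements gives a left Noetherian ring. -/
theorem isNoetherianRing_closure_union_image [IsNoetherianRing A]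
    (hl : ∀ i, ∀ a ∈ A, ∃ b ∈ A, x i * a = b * x i)
    (hr : ∀ i, ∀ a ∈ A, ∃ b ∈ A, a * x i = x i * b)
    (hq : ∀ i j, ∃ b ∈ A, x j * x i = b * x i * x j) (s : Finset ι) :
    IsNoetherianRing (Subring.closure (A ∪ x '' s : Set T)) := by
  classical
  induction s using Finset.induction_on with
  | empty =>
    have h : Subring.closure (A ∪ x '' ((∅ : Finset ι) : Set ι) : Set T) = A := by simp
    rw [h]; infer_instance
  | insert i s _ ih =>
    set P := Subring.closure (A ∪ x '' (s : Set ι) : Set T)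
    set P' := Subring.closure (A ∪ x '' ((insert i s : Finset ι) : Set ι) : Set T)
    have hle : P ≤ P' := Subring.closure_mono (Set.union_subset_union_right _
      (Set.image_mono (Finset.coe_subset.mpr (Finset.subset_insert i s))))
    have hx : x i ∈ P' := Subring.subset_closure (Or.inr ⟨i, by simp, rfl⟩)
    refine isNoetherianRing_of_closure_insert (f := Subring.inclusion hle) (x := ⟨x i, hx⟩)
      ?_ ?_ ?_
    · rintro ⟨a, ha⟩
      obtain ⟨b, hb, h⟩ := var_mul_closure hl hq s i a ha
      exact ⟨⟨b, hb⟩, Subtype.ext h⟩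
    · rintro ⟨a, ha⟩
      obtain ⟨b, hb, h⟩ := closure_mul_var hr hq s i a ha
      exact ⟨⟨b, hb⟩, Subtype.ext h⟩
    · rw [eq_top_iff, ← closure_preimage_subtype_closure
        (A ∪ x '' ((insert i s : Finset ι) : Set ι))]
      refine Subring.closure_mono ?_
      rintro ⟨a, haP'⟩ (ha | ⟨j, hj, rfl⟩)
      · exact Or.inl ⟨⟨a, Subring.subset_closure (Or.inl ha)⟩, rfl⟩
      · rcases Finset.mem_insert.mp hj with rfl | hj
        · exact Or.inr rfl
        · exact Or.inl ⟨⟨x j, Subring.subset_closure (Or.inr ⟨j, hj, rfl⟩)⟩, rfl⟩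

end Iteration

/-! ### Inverting normal elements -/

section Localization

variable {T : Type*} [Ring T]

/-- The units of `T` which lie in the subring `P` and satisfy `u P ⊆ P u`. -/
def normalUnits (P : Subring T) : Submonoid T where
  carrier := {u | IsUnit u ∧ u ∈ P ∧ ∀ p ∈ P, ∃ p' ∈ P, u * p = p' * u}
  one_mem' := ⟨isUnit_one, one_mem _, fun p hp => ⟨p, hp, by simp⟩⟩
  mul_mem' := by
    rintro u v ⟨hu, huP, hu'⟩ ⟨hv, hvP, hv'⟩
    refine ⟨hu.mul hv, mul_mem huP hvP, fun p hp => ?_⟩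
    obtain ⟨p', hp', h⟩ := hv' p hp
    obtain ⟨p'', hp'', h'⟩ := hu' p' hp'
    exact ⟨p'', hp'', by rw [mul_assoc, h, ← mul_assoc, h', mul_assoc]⟩

variable {P : Subring T}

/-- Clearing denominators from the left; normality plays the role of the Ore condition. -/
theorem exists_normalUnit_mul_mem {V : Set T}
    (hV : ∀ v ∈ V, ∃ u ∈ normalUnits P, u * v = 1)
    (hgen : Subring.closure (P ∪ V) = ⊤) (t : T) : ∃ u ∈ normalUnits P, u * t ∈ P := by
  have key : ∀ y ∈ Subring.closure (P ∪ V), ∀ t, (∃ u ∈ normalUnits P, u * t ∈ P) →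
      ∃ u ∈ normalUnits P, u * (t * y) ∈ P := by
    intro y hy
    induction hy using Subring.closure_induction with
    | mem y hy =>
      rintro t ⟨u, hu, hut⟩
      rcases hy with hy | hy
      · exact ⟨u, hu, by rw [← mul_assoc]; exact mul_mem hut hy⟩
      · obtain ⟨w, hw, hwy⟩ := hV y hy
        -- Moving `w` rightwards past `u * t` brings it next to its inverse `y`, where the two
        -- cancel.
        obtain ⟨p, hp, h⟩ := hw.2.2 _ hut
        refine ⟨w * u, mul_mem hw hu, ?_⟩
        rwa [← mul_assoc, mul_assoc w u t, h, mul_assoc, hwy, mul_one]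
    | zero => exact fun t _ => ⟨1, one_mem _, by simp⟩
    | one => intro t ht; simpa using ht
    | add a b _ _ ha hb =>
      intro t ht
      obtain ⟨u, hu, hut⟩ := ha t ht
      obtain ⟨w, hw, hwt⟩ := hb t ht
      obtain ⟨p, hp, h⟩ := hw.2.2 u hu.2.1
      refine ⟨w * u, mul_mem hw hu, ?_⟩
      rw [mul_add, mul_add]
      refine add_mem ?_ ?_
      · rw [mul_assoc]; exact mul_mem hw.2.1 hut
      · rw [h, mul_assoc]; exact mul_mem hp hwt
    | neg a _ ha =>
      intro t ht
      obtain ⟨u, hu, hut⟩ := ha t ht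
      exact ⟨u, hu, by rw [mul_neg, mul_neg]; exact neg_mem hut⟩
    | mul a b _ _ ha hb =>
      intro t ht
      rw [← mul_assoc]
      exact hb _ (ha t ht)
  simpa using key t (hgen ▸ Subring.mem_top t) 1 ⟨1, one_mem _, by simp⟩

/-- A ring obtained from a left Noetherian subring by inverting normal elements is left
Noetherian. -/
theorem isNoetherianRing_of_normalUnits [IsNoetherianRing P] {V : Set T}
    (hV : ∀ v ∈ V, ∃ u ∈ normalUnits P, u * v = 1)
    (hgen : Subring.closure (P ∪ V) = ⊤) : IsNoetherianRing T := by
  -- Contraction reflects inclusions because the denominators are units of `T`; hence it is strictly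
  -- monotone and the chain condition pulls back from `P`.
  have hle : ∀ I J : Ideal T, I.comap P.subtype ≤ J.comap P.subtype → I ≤ J := by
    intro I J h t ht
    obtain ⟨u, hu, hut⟩ := exists_normalUnit_mul_mem hV hgen t
    have hJ : u * t ∈ J := h (show (⟨u * t, hut⟩ : P) ∈ I.comap P.subtype from
      I.mul_mem_left u ht)
    obtain ⟨w, hw⟩ := hu.1.exists_left_inv
    simpa [← mul_assoc, hw] using J.mul_mem_left w hJ
  have hP : WellFoundedGT (Ideal P) := isNoetherian_iff'.mp ‹IsNoetherianRing P›
  have hmono : StrictMono fun I : Ideal T => I.comap P.subtype :=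
    fun I J h => ⟨Ideal.comap_mono h.le, fun h' => h.not_ge (hle _ _ h')⟩
  exact isNoetherian_iff'.mpr hmono.wellFoundedGT

variable {ι : Type*} [Fintype ι] {A : Subring T} {x : ι → T}

theorem isNoetherianRing_of_normalizing_generators [IsNoetherianRing A]
    (hl : ∀ i, ∀ a ∈ A, ∃ b ∈ A, x i * a = b * x i)
    (hr : ∀ i, ∀ a ∈ A, ∃ b ∈ A, a * x i = x i * b)
    (hq : ∀ i j, ∃ b ∈ A, x j * x i = b * x i * x j)
    (hgen : Subring.closure (A ∪ Set.range x ∪ {v | ∃ i, x i * v = 1 ∧ v * x i = 1}) = ⊤) :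
    IsNoetherianRing T := by
  have := isNoetherianRing_closure_union_image hl hr hq Finset.univ
  refine isNoetherianRing_of_normalUnits
    (P := Subring.closure (A ∪ x '' ((Finset.univ : Finset ι) : Set ι) : Set T))
    (V := {v | ∃ i, x i * v = 1 ∧ v * x i = 1}) ?_ ?_
  · rintro v ⟨i, h, h'⟩
    exact ⟨x i, ⟨⟨⟨x i, v, h, h'⟩, rfl⟩, Subring.subset_closure (Or.inr ⟨i, by simp, rfl⟩),
      var_mul_closure hl hq _ i⟩, h⟩
  · rw [eq_top_iff, ← hgen]
    refine Subring.closure_mono (Set.union_subset_union_left _ ?_)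
    simp

end Localization

/-! ### Skew quantum polynomials and base change -/

section Application

variable {R Q : Type*} [Ring R] [Ring Q] {n r : ℕ} {q : Matrix (Fin n) (Fin n) R}
  {σ : Fin n → (R ≃+* R)} {ι : R →+* Q} {x : Fin n → Q}

theorem IsSkewQuantumPolynomialRing.closure_eq_top
    (hQ : IsSkewQuantumPolynomialRing r q σ ι x) :
    Subring.closure (ι.range ∪ Set.range x ∪ {v | ∃ i, x i * v = 1 ∧ v * x i = 1}) = ⊤ := by
  rw [eq_top_iff]
  rintro y -
  obtain ⟨c, rfl⟩ := hQ.basis.2 y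
  refine sum_mem fun α _ => mul_mem (Subring.subset_closure (Or.inl (Or.inl ⟨_, rfl⟩))) ?_
  refine list_prod_mem fun z hz => ?_
  obtain ⟨i, rfl⟩ := (List.mem_ofFn' _ _).mp hz
  have hx : x i ∈ Subring.closure (ι.range ∪ Set.range x ∪
      {v | ∃ i, x i * v = 1 ∧ v * x i = 1}) := Subring.subset_closure (Or.inl (Or.inr ⟨i, rfl⟩))
  rcases lt_or_ge (i : ℕ) r with hi | hi
  · have hu := hQ.isUnit i hi
    beta_reduce
    cases (α : Fin n → ℤ) i with
    | ofNat k => exact pow_mem hx k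
    | negSucc k =>
      have hv : Ring.inverse (x i) ∈ Subring.closure (ι.range ∪ Set.range x ∪
          {v | ∃ i, x i * v = 1 ∧ v * x i = 1}) := Subring.subset_closure (Or.inr
        ⟨i, Ring.mul_inverse_cancel _ hu, Ring.inverse_mul_cancel _ hu⟩)
      exact pow_mem hv (k + 1)
  · obtain ⟨k, hk⟩ := Int.eq_ofNat_of_zero_le (α.2 i hi)
    beta_reduce
    rw [hk]
    exact pow_mem hx k

theorem IsSkewQuantumPolynomialRing.isNoetherianRing
    (hQ : IsSkewQuantumPolynomialRing r q σ ι x) [IsNoetherianRing R] : IsNoetherianRing Q := by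
  refine isNoetherianRing_of_normalizing_generators (A := ι.range) (x := x) ?_ ?_ ?_
    hQ.closure_eq_top
  · rintro i _ ⟨a, rfl⟩
    exact ⟨_, ⟨σ i a, rfl⟩, hQ.mul_coeff i a⟩
  · rintro i _ ⟨a, rfl⟩
    exact ⟨_, ⟨(σ i).symm a, rfl⟩, by simp [hQ.mul_coeff]⟩
  · exact fun i j => ⟨_, ⟨q i j, rfl⟩, hQ.mul_comm_var i j⟩

end Application

theorem IsSkewQuantumPolynomialRing.isNoetherianRing_tensorProduct
    {K R Q : Type*} [CommRing K] [Ring R] [Ring Q] [Algebra K R] [Algebra K Q] {n r : ℕ}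
    {q : Matrix (Fin n) (Fin n) R} {σ : Fin n → (R ≃+* R)} {ι : R →ₐ[K] Q} {x : Fin n → Q}
    (hQ : IsSkewQuantumPolynomialRing r q σ (ι : R →+* Q) x)
    (C : Type*) [CommRing C] [Algebra K C] [IsNoetherianRing (C ⊗[K] R)] :
    IsNoetherianRing (C ⊗[K] Q) := by
  set F : C ⊗[K] R →+* C ⊗[K] Q :=
    ((Algebra.TensorProduct.map (AlgHom.id K C) ι : C ⊗[K] R →ₐ[K] C ⊗[K] Q) :
      C ⊗[K] R →+* C ⊗[K] Q) with hF
  have hFt : ∀ c a, F (c ⊗ₜ a) = c ⊗ₜ ι a := fun c a => by simp [hF]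
  refine isNoetherianRing_of_normalizing_generators (A := F.range)
    (x := fun i => (1 : C) ⊗ₜ[K] x i) ?_ ?_ ?_ ?_
  · rintro i _ ⟨t, rfl⟩
    induction t with
    | zero => exact ⟨0, zero_mem _, by simp⟩
    | tmul c a =>
      refine ⟨_, ⟨c ⊗ₜ σ i a, rfl⟩, ?_⟩
      have := hQ.mul_coeff i a
      simp only [RingHom.coe_coe] at this
      simp [hFt, this]
    | add s t hs ht =>
      obtain ⟨b, hb, h⟩ := hs
      obtain ⟨d, hd, h'⟩ := ht
      exact ⟨b + d, add_mem hb hd, by rw [map_add, mul_add, add_mul, h, h']⟩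
  · rintro i _ ⟨t, rfl⟩
    induction t with
    | zero => exact ⟨0, zero_mem _, by simp⟩
    | tmul c a =>
      refine ⟨_, ⟨c ⊗ₜ (σ i).symm a, rfl⟩, ?_⟩
      have := hQ.mul_coeff i ((σ i).symm a)
      simp only [RingHom.coe_coe, RingEquiv.apply_symm_apply] at this
      simp [hFt, this]
    | add s t hs ht =>
      obtain ⟨b, hb, h⟩ := hs
      obtain ⟨d, hd, h'⟩ := ht
      exact ⟨b + d, add_mem hb hd, by rw [map_add, mul_add, add_mul, h, h']⟩
  · intro i j
    refine ⟨_, ⟨1 ⊗ₜ q i j, rfl⟩, ?_⟩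
    have := hQ.mul_comm_var i j
    simp only [RingHom.coe_coe] at this
    simp [hFt, this]
  · set B := Subring.closure ((F.range : Set (C ⊗[K] Q)) ∪
      Set.range (fun i => (1 : C) ⊗ₜ[K] x i) ∪
      {v | ∃ i, (1 : C) ⊗ₜ[K] x i * v = 1 ∧ v * (1 : C) ⊗ₜ[K] x i = 1}) with hB
    -- Generation of `Q` carries over along `y ↦ 1 ⊗ y`; the elements `c ⊗ 1` already lie in the
    -- image of `C ⊗ R`.
    have hright : ∀ y : Q, (1 : C) ⊗ₜ[K] y ∈ B := by
      have hle : (⊤ : Subring Q) ≤ B.comap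
          ((Algebra.TensorProduct.includeRight : Q →ₐ[K] C ⊗[K] Q) : Q →+* C ⊗[K] Q) := by
        rw [← hQ.closure_eq_top, Subring.closure_le]
        rintro y ((⟨a, rfl⟩ | ⟨i, rfl⟩) | ⟨i, h, h'⟩)
        · exact Subring.subset_closure (Or.inl (Or.inl ⟨1 ⊗ₜ a, hFt 1 a⟩))
        · exact Subring.subset_closure (Or.inl (Or.inr ⟨i, rfl⟩))
        · refine Subring.subset_closure (Or.inr ⟨i, ?_, ?_⟩)
          · simp [h, Algebra.TensorProduct.one_def]
          · simp [h', Algebra.TensorProduct.one_def]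
      exact fun y => hle (Subring.mem_top y)
    rw [eq_top_iff]
    rintro t -
    induction t with
    | zero => exact zero_mem _
    | tmul c y =>
      have hc : c ⊗ₜ[K] (1 : Q) ∈ B :=
        Subring.subset_closure (Or.inl (Or.inl ⟨c ⊗ₜ 1, by simp [hFt]⟩))
      simpa using mul_mem hc (hright y)
    | add s t hs ht => exact add_mem hs ht

end SkewQuantum

theorem mainTheorem6 {K : Type u} {R : Type v} {Q : Type t}
    [CommRing K] [Ring R] [Ring Q] [Algebra K R] [Algebra K Q]
    (n r : ℕ) (hn : 2 ≤ n) (hr : r ≤ n)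
    (q : Matrix (Fin n) (Fin n) R)
    (hq_diag : ∀ i, q i i = 1) (hq_inv : ∀ i j, q i j * q j i = 1)
    (σ : Fin n → (R ≃+* R))
    (ι : R →ₐ[K] Q) (x : Fin n → Q)
    (hQ : SkewQuantum.IsSkewQuantumPolynomialRing r q σ (ι : R →+* Q) x)
    (hR : IsLeftStronglyNoetherian.{w} K R) :
    IsLeftStronglyNoetherian.{w} K Q := by
  have := hR.1
  refine ⟨hQ.isNoetherianRing, fun C _ _ hC => ?_⟩
  have := hR.2 C hC
  exact hQ.isNoetherianRing_tensorProduct C
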